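/- Let $d\in\mathbb N$, $S=\mathbb R^d\times\mathbb R\times(0,\infty)$, let $\pi$ be a probability measure on $(0,\infty)$ (for instance $\pi(\mathrm d\lambda)=f(\lambda)\,\mathrm d\lambda$ with a probability density $f$), put $\tilde c(\mathrm d\xi,\mathrm ds,\mathrm d\lambda)=\mathrm d\xi\,\mathrm ds\,\pi(\mathrm d\lambda)$, and let $\mathcal B_b(S)$ be the class of Borel sets $E\subset S$ of finite Lebesgue measure with $\tilde c(E)<\infty$. Let $(\Omega,\mathcal F,P)$ be a probability space. A *Lévy basis* is a family $L=\{L(E):E\in\mathcal B_b(S)\}$ of real random variables such that, for all disjoint $E_1,E_2,\dots\in\mathcal B_b(S)$, the variables $L(E_1),L(E_2),\dots$ are independent, and $L(\bigcup_jE_j)=\sum_jL(E_j)$ almost surely whenever $\bigcup_jE_j\in\mathcal B_b(S)$; and such that $(L(B_1),\dots,L(B_m))$ is infinitely divisible for all $B_1,\dots,B_m\in\mathcal B_b(S)$. Suppose that $L$ has characteristic quadruplet $(a,b,\nu,\tilde c)$ with $a\in\mathbb R$, $b\ge0$ and $\nu$ a measure on $\mathbb R$ with $\int\min(1,z^2)\,\nu(\mathrm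 dz)<\infty$, that is, for all $E\in\mathcal B_b(S)$ and $\theta\in\mathbb R$, $$\mathbb E\big[e^{i\theta L(E)}\big]=\exp\Big(\tilde c(E)\Big[i\theta a-\tfrac12\theta^2b+\int_{\mathbb R}\big(e^{i\theta z}-1-i\theta z\mathbf 1_{|z|\le1}\big)\nu(\mathrm dz)\Big]\Big).$$ For a simple function $g=\sum_{j=1}^m y_j\mathbf 1_{E_j}$ with disjoint $E_j\in\mathcal B_b(S)$ and a Borel set $B\subset S$ put $\int_Bg\,\mathrm dL=\sum_jy_jL(B\cap E_j)$. A measurable $g:S\to\mathbb R$ is *$L$-integrable* if there are simple functions $g_n\to g$ $\tilde c$-almost everywhere such that $\int_Bg_n\,\mathrm dL$ converges in probability for every Borel set $B\subset S$; then $\int_Sg\,\mathrm dL$ is the limit in probability of $\int_Sg_n\,\mathrm dL$. Let $A_t(x)\subset\mathbb R^d\times\mathbb R$ ($x\in\mathbb R^d$, $t\in\mathbb R$) be Borel sets with $A_t(x)=A_0(0)+(x,t)$, $A_s(x)\subset A_t(x)$ for $s<t$, and $A_t(x)\cap(\mathbb R^d\times(t,\infty))=\emptyset$, and suppose that $(\xi,s,\lambda)\mapsto\mathbf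 1_{A_t(x)}(\xi,s)e^{-\lambda(t-s)}$ is $L$-integrable for all $x,t$. The *mixed spatio-temporal Ornstein–Uhlenbeck (MSTOU) process* is $$Y_t(x)=\int_0^\infty\int_{A_t(x)}e^{-\lambda(t-s)}\,L(\mathrm d\xi,\mathrm ds,\mathrm d\lambda).$$ **Theorem.** Every MSTOU process is strictly stationary in space-time: for all $n\in\mathbb N$, $x_1,\dots,x_n,u\in\mathbb R^d$ and $t_1,\dots,t_n,\varepsilon\in\mathbb R$, the random vectors $(Y_{t_1}(x_1),\dots,Y_{t_n}(x_n))$ and $(Y_{t_1+\varepsilon}(x_1+u),\dots,Y_{t_n+\varepsilon}(x_n+u))$ have the same distribution. -/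

import Mathlib

open MeasureTheory ProbabilityTheory Filter

noncomputable section

namespace MSTOU

/-- Space-time `ℝᵈ × ℝ`, with points `(ξ, s)`. -/
abbrev SpaceTime (d : ℕ) : Type := EuclideanSpace ℝ (Fin d) × ℝ

/-- The space `S = ℝᵈ × ℝ × (0, ∞)`, with points `((ξ, s), lam)`. -/
abbrev ParamSpace (d : ℕ) : Type := SpaceTime d × Set.Ioi (0 : ℝ)

/-- The control measure `dξ ds π(dlam)`. -/
def controlMeasure (d : ℕ) (π : Measure (Set.Ioi (0 : ℝ))) : Measure (ParamSpace d) :=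
  (volume : Measure (SpaceTime d)).prod π

/-- Lebesgue measure `dξ ds dlam` on `S`. -/
def lebesgue (d : ℕ) : Measure (ParamSpace d) :=
  (volume : Measure (SpaceTime d)).prod ((volume : Measure ℝ).comap Subtype.val)

/-- The sets on which a Lévy basis with control measure `dξ ds π(dlam)` is defined: the Borel sets
of finite Lebesgue measure on which the control measure is finite. (The cumulants of the basis are
finite only on sets of finite control measure. If `π` has a bounded density, then this class
consists of all the Borel sets of finite Lebesgue measure.) -/
def boundedSets (d : ℕ) (π : Measure (Set.Ioi (0 : ℝ))) : Set (Set (ParamSpace d)) :=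
  {E | MeasurableSet E ∧ lebesgue d E < ⊤ ∧ controlMeasure d π E < ⊤}

/-- The `n`-fold convolution of `ρ` with itself. -/
def convPow {m : ℕ} (ρ : Measure (Fin m → ℝ)) : ℕ → Measure (Fin m → ℝ)
  | 0 => Measure.dirac 0
  | n + 1 => (convPow ρ n).conv ρ

/-- Infinite divisibility of a law on `ℝᵐ`. -/
def IsInfinitelyDivisible {m : ℕ} (μ : Measure (Fin m → ℝ)) : Prop :=
  ∀ n : ℕ, 0 < n → ∃ ρ : Measure (Fin m → ℝ), IsProbabilityMeasure ρ ∧ μ = convPow ρ n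

section Basis

variable {S Ω : Type*} [MeasurableSpace S] [MeasurableSpace Ω]

/-- A Lévy basis indexed by the class `𝓑` of sets: an independently scattered, infinitely
divisible random measure. The values of `L` outside `𝓑` are irrelevant. -/
structure IsLevyBasis (P : Measure Ω) (𝓑 : Set (Set S)) (L : Set S → Ω → ℝ) : Prop where
  measurable : ∀ E ∈ 𝓑, Measurable (L E)
  /-- The series converges almost surely in the given order (not absolutely, in general). -/
  sigma_additive : ∀ E : ℕ → Set S, (∀ j, E j ∈ 𝓑) → Pairwise (Function.onFun Disjoint E) →
    (⋃ j, E j) ∈ 𝓑 →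
    ∀ᵐ ω ∂P, Tendsto (fun n => ∑ j ∈ Finset.range n, L (E j) ω) atTop (nhds (L (⋃ j, E j) ω))
  indep : ∀ E : ℕ → Set S, (∀ j, E j ∈ 𝓑) → Pairwise (Function.onFun Disjoint E) →
    iIndepFun (fun j => L (E j)) P
  infinitely_divisible : ∀ (m : ℕ) (B : Fin m → Set S), (∀ i, B i ∈ 𝓑) →
    IsInfinitelyDivisible (P.map (fun ω i => L (B i) ω))

/-- The Lévy–Khintchine exponent of the triplet `(a, b, ν)`. -/
def levyExponent (a b : ℝ) (ν : Measure ℝ) (θ : ℝ) : ℂ :=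
  Complex.I * θ * a - θ ^ 2 * b / 2 +
    ∫ z : ℝ, (Complex.exp (Complex.I * θ * z) - 1 -
      Complex.I * θ * (if |z| ≤ 1 then z else 0 : ℝ)) ∂ν

/-- `L` has the characteristic quadruplet `(a, b, ν, c)`, with `a`, `b` and `ν` not depending on
the point of `S`: `ν` is a Lévy measure and, for `E ∈ 𝓑`, the cumulant function of `L(E)` is
`c(E)` times the Lévy–Khintchine exponent of `(a, b, ν)`. -/
structure HasCharQuadruplet (P : Measure Ω) (𝓑 : Set (Set S)) (L : Set S → Ω → ℝ)
    (a b : ℝ) (ν : Measure ℝ) (c : Measure S) : Prop where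
  nonneg : 0 ≤ b
  levy_measure : ∫⁻ z : ℝ, ENNReal.ofReal (min 1 (z ^ 2)) ∂ν < ⊤
  finite : ∀ E ∈ 𝓑, c E < ⊤
  levy_khintchine : ∀ E ∈ 𝓑, ∀ θ : ℝ,
    charFun (P.map (L E)) θ = Complex.exp (c.real E * levyExponent a b ν θ)

/-- The data of a simple function `∑ j, y j • 1_{E j}` with disjoint `E j ∈ 𝓑`. -/
structure SimpleFn (𝓑 : Set (Set S)) where
  m : ℕ
  E : Fin m → Set S
  y : Fin m → ℝ
  mem : ∀ j, E j ∈ 𝓑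
  disjoint : Pairwise (Function.onFun Disjoint E)

/-- The simple function itself. -/
def SimpleFn.eval {𝓑 : Set (Set S)} (g : SimpleFn 𝓑) (z : S) : ℝ :=
  ∑ j, (g.E j).indicator (fun _ => g.y j) z

/-- The stochastic integral of a simple function over `A`. -/
def SimpleFn.integral {𝓑 : Set (Set S)} (g : SimpleFn 𝓑) (L : Set S → Ω → ℝ) (A : Set S)
    (ω : Ω) : ℝ :=
  ∑ j, g.y j * L (A ∩ g.E j) ω

/-- `g` is `L`-integrable and the random variable `Z` is (a version of) `∫_S g dL`: there are
simple functions converging to `g` almost everywhere with respect to the control measure, whose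
integrals over every measurable set converge in probability, the integrals over `S` to `Z`. -/
def IsStochIntegral (P : Measure Ω) (𝓑 : Set (Set S)) (L : Set S → Ω → ℝ) (c : Measure S)
    (g : S → ℝ) (Z : Ω → ℝ) : Prop :=
  Measurable g ∧ AEMeasurable Z P ∧
  ∃ gs : ℕ → SimpleFn 𝓑,
    (∀ᵐ z ∂c, Tendsto (fun n => (gs n).eval z) atTop (nhds (g z))) ∧
    (∀ A : Set S, MeasurableSet A → ∃ W : Ω → ℝ, AEMeasurable W P ∧
      TendstoInMeasure P (fun n => (gs n).integral L A) atTop W) ∧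
    TendstoInMeasure P (fun n => (gs n).integral L Set.univ) atTop Z

end Basis

/-- The conditions on the ambit sets `A_t(x)`. -/
structure IsAmbit {d : ℕ} (A : ℝ → EuclideanSpace ℝ (Fin d) → Set (SpaceTime d)) : Prop where
  measurable : ∀ t x, MeasurableSet (A t x)
  translation : ∀ t x, A t x = (fun p => p + (x, t)) '' A 0 0
  mono : ∀ s t x, s < t → A s x ⊆ A t x
  nonanticipative : ∀ t x, A t x ∩ {p | t < p.2} = ∅

/-- The integrand `1_{A_t(x)}(ξ, s) exp(-lam (t - s))`. -/
def kernel {d : ℕ} (A : ℝ → EuclideanSpace ℝ (Fin d) → Set (SpaceTime d))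
    (t : ℝ) (x : EuclideanSpace ℝ (Fin d)) : ParamSpace d → ℝ :=
  Set.indicator {z | z.1 ∈ A t x} (fun z => Real.exp (-(z.2 : ℝ) * (t - z.1.2)))

/-- `Y` is an MSTOU process: `Y_t(x) = ∫_0^∞ ∫_{A_t(x)} exp(-lam (t - s)) L(dξ, ds, dlam)` for
ambit sets `A_t(x)` and a Lévy basis `L` with characteristic quadruplet `(a, b, ν, dξ ds π(dlam))`, where
`π` is a probability measure on `(0, ∞)`. -/
def IsMSTOU {d : ℕ} {Ω : Type*} [MeasurableSpace Ω] (P : Measure Ω)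
    (Y : ℝ → EuclideanSpace ℝ (Fin d) → Ω → ℝ) : Prop :=
  ∃ (π : Measure (Set.Ioi (0 : ℝ))) (a b : ℝ) (ν : Measure ℝ)
    (L : Set (ParamSpace d) → Ω → ℝ)
    (A : ℝ → EuclideanSpace ℝ (Fin d) → Set (SpaceTime d)),
    IsProbabilityMeasure π ∧
    IsLevyBasis P (boundedSets d π) L ∧
    HasCharQuadruplet P (boundedSets d π) L a b ν (controlMeasure d π) ∧
    IsAmbit A ∧
    ∀ t x, IsStochIntegral P (boundedSets d π) L (controlMeasure d π)
      (kernel A t x) (Y t x)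

/-- Strict stationarity in space-time: all finite-dimensional distributions are invariant under
joint shifts in space and time. -/
def IsStationary {d : ℕ} {Ω : Type*} [MeasurableSpace Ω] (P : Measure Ω)
    (Y : ℝ → EuclideanSpace ℝ (Fin d) → Ω → ℝ) : Prop :=
  ∀ (n : ℕ) (x : Fin n → EuclideanSpace ℝ (Fin d)) (t : Fin n → ℝ)
    (u : EuclideanSpace ℝ (Fin d)) (ε : ℝ),
    IdentDistrib (fun ω i => Y (t i) (x i) ω) (fun ω i => Y (t i + ε) (x i + u) ω) P P

end MSTOU

end

/-! The shift `τ` by `(u, ε)` in space-time, which fixes the rate, preserves the control measure `c`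
and carries each kernel to the shifted one. For simple functions `g i` the integrals over `A` have
joint characteristic function `exp (∫_A ψ(∑ θ i * g i) dc)`, with `ψ` the Lévy–Khintchine exponent
(`charFun_map_sum_integral`), so only `c` and the integrands matter.

The difficulty is the passage to the limit, since almost everywhere convergence of the integrands
does not control these integrals. Take approximations `g n` of the kernels and `g' n` of the shifted
kernels. Then `H n = ψ(∑ θ g n) - ψ(∑ θ g' n) ∘ τ` tends to `0` almost everywhere. For every `A`,
`exp (∫_A H n)` is a quotient of characteristic functions and converges: integrals over every set
converge in probability, and the limiting denominator is nonzero (`charFun_limit_ne_zero`). A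
gliding-hump argument (`tendsto_exp_integral_of_ae_tendsto_zero`) then forces `exp (∫ H n) → 1`, so
the two limiting characteristic functions agree. -/

namespace MSTOU

open scoped Topology

/-! ### Gliding hump: almost everywhere convergence and setwise limits of exponentials -/

section Analytic

variable {S : Type*} [MeasurableSpace S]

/-- A sequence of integrable functions tending to `0` almost everywhere is uniformly small, in
mean, on the sets of an exhaustion. -/
theorem exists_exhaustion_of_ae_tendsto_zero (c : Measure S) [SigmaFinite c] {H : ℕ → S → ℂ}
    (hm : ∀ n, Measurable (H n)) (hi : ∀ n, Integrable (H n) c)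
    (h0 : ∀ᵐ z ∂c, Tendsto (fun n => H n z) atTop (𝓝 0)) :
    ∃ C : ℕ → Set S, Monotone C ∧ (∀ j, MeasurableSet (C j)) ∧
      (∀ j, Tendsto (fun n => ∫ z in C j, ‖H n z‖ ∂c) atTop (𝓝 0)) ∧
      ∀ n, Tendsto (fun j => ∫ z in (C j)ᶜ, ‖H n z‖ ∂c) atTop (𝓝 0) := by
  -- The exhausting sets have finite measure, and all `H n` are bounded by `j` on the `j`-th one, so
  -- the constant `j` dominates there.
  have hCm : ∀ j : ℕ, MeasurableSet (spanningSets c j ∩ {z | ∀ n, ‖H n z‖ ≤ j}) := by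
    intro j
    refine (measurableSet_spanningSets c j).inter ?_
    rw [Set.ofPred_forall]
    exact MeasurableSet.iInter fun n => measurableSet_le (hm n).norm measurable_const
  have hmono : Monotone fun j : ℕ => spanningSets c j ∩ {z | ∀ n, ‖H n z‖ ≤ j} := by
    intro i j hij z hz
    refine ⟨monotone_spanningSets c hij hz.1, fun n => (hz.2 n).trans ?_⟩
    exact_mod_cast hij
  refine ⟨_, hmono, hCm, fun j => ?_, fun n => ?_⟩
  · have hfin : c (spanningSets c j ∩ {z | ∀ n, ‖H n z‖ ≤ j}) < ⊤ :=
      (measure_mono Set.inter_subset_left).trans_lt (measure_spanningSets_lt_top c j)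
    have := tendsto_integral_of_dominated_convergence
      (μ := c.restrict (spanningSets c j ∩ {z | ∀ n, ‖H n z‖ ≤ j}))
      (F := fun n z => ‖H n z‖) (f := fun _ => (0 : ℝ)) (fun _ => (j : ℝ))
      (fun n => (hm n).norm.aestronglyMeasurable)
      (by
        have : IsFiniteMeasure (c.restrict (spanningSets c j ∩ {z | ∀ n, ‖H n z‖ ≤ j})) :=
          ⟨by simpa using hfin⟩
        exact integrable_const _)
      (fun n => by
        filter_upwards [ae_restrict_mem (hCm j)] with z hz
        simpa using hz.2 n)
      (by
        filter_upwards [ae_restrict_of_ae h0] with z hz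
        simpa using hz.norm)
    simpa using this
  · have := tendsto_setIntegral_of_antitone (μ := c) (f := fun z => ‖H n z‖)
      (fun j => (hCm j).compl) (fun i j hij => Set.compl_subset_compl.2 (hmono hij))
      ⟨0, (hi n).norm.integrableOn⟩
    convert! this using 2
    symm
    apply setIntegral_measure_zero
    -- The exhaustion covers almost every point because a convergent sequence is bounded.
    rw [← Set.compl_iUnion, ← mem_ae_iff]
    filter_upwards [h0] with z hz
    obtain ⟨M, hM⟩ := hz.norm.bddAbove_range
    obtain ⟨K, hK⟩ := exists_nat_ge M
    refine Set.mem_iUnion.2 ⟨max K (spanningSetsIndex c z), ?_, fun n => ?_⟩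
    · exact monotone_spanningSets c (le_max_right _ _) (mem_spanningSetsIndex c z)
    · refine (hM ⟨n, rfl⟩).trans (hK.trans ?_)
      exact_mod_cast le_max_left _ _

/-- If integrable functions tend to `0` almost everywhere and the exponentials of their integrals
over every measurable set converge, then the exponentials of the full integrals tend to `1`. -/
theorem tendsto_exp_integral_of_ae_tendsto_zero (c : Measure S) [SigmaFinite c] {H : ℕ → S → ℂ}
    (hm : ∀ n, Measurable (H n)) (hi : ∀ n, Integrable (H n) c)
    (h0 : ∀ᵐ z ∂c, Tendsto (fun n => H n z) atTop (𝓝 0))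
    (hc : ∀ A, MeasurableSet A →
      ∃ l, Tendsto (fun n => Complex.exp (∫ z in A, H n z ∂c)) atTop (𝓝 l)) :
    Tendsto (fun n => Complex.exp (∫ z, H n z ∂c)) atTop (𝓝 1) := by
  obtain ⟨C, hmono, hCm, hC, hC'⟩ := exists_exhaustion_of_ae_tendsto_zero c hm hi h0
  have hN : ∀ j i : ℕ, ∃ n, i ≤ n ∧ ∫ z in C j, ‖H n z‖ ∂c < 1 / ((i : ℝ) + 1) := fun j i =>
    ((eventually_ge_atTop i).and ((hC j).eventually (gt_mem_nhds (by positivity)))).exists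
  have hJ : ∀ n i j : ℕ, ∃ k, j ≤ k ∧ ∫ z in (C k)ᶜ, ‖H n z‖ ∂c < 1 / ((i : ℝ) + 1) :=
    fun n i j =>
    ((eventually_ge_atTop j).and ((hC' n).eventually (gt_mem_nhds (by positivity)))).exists
  choose N hNi hN using hN
  choose J hJj hJ using hJ
  -- Alternating choice: given `k i`, pick an index `n i` for which `H (n i)` is small in mean on `C
  -- (k i)`, then `k (i + 1)` so large that it is also small off `C (k (i + 1))`. The mass of `H (n
  -- i)` thus sits on the `i`-th annulus, up to `2 / (i + 1)`.
  let k : ℕ → ℕ := fun i => Nat.rec 0 (fun i j => J (N j i) i j) i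
  have hk : Monotone k := monotone_nat_of_le_succ fun i => hJj _ _ _
  set n : ℕ → ℕ := fun i => N (k i) i with hn
  have hntop : Tendsto n atTop atTop := tendsto_atTop_mono (fun i => hNi _ _) tendsto_id
  have hsmall : ∀ (B : Set S) (i : ℕ), MeasurableSet B → B ⊆ C (k i) ∪ (C (k (i + 1)))ᶜ →
      ‖∫ z in B, H (n i) z ∂c‖ ≤ 2 * (1 / ((i : ℝ) + 1)) := by
    intro B i hB hsub
    have hint : Integrable (fun z => ‖H (n i) z‖) c := (hi _).norm
    calc ‖∫ z in B, H (n i) z ∂c‖ ≤ ∫ z in B, ‖H (n i) z‖ ∂c := norm_integral_le_integral_norm _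
      _ ≤ ∫ z in C (k i) ∪ (C (k (i + 1)))ᶜ, ‖H (n i) z‖ ∂c :=
        setIntegral_mono_set hint.integrableOn (Eventually.of_forall fun _ => norm_nonneg _)
          hsub.eventuallyLE
      _ = ∫ z in C (k i), ‖H (n i) z‖ ∂c + ∫ z in (C (k (i + 1)))ᶜ, ‖H (n i) z‖ ∂c :=
        setIntegral_union
          (Set.disjoint_compl_right_iff_subset.2 (hmono (hk (Nat.le_succ i))))
          (hCm _).compl hint.integrableOn hint.integrableOn
      _ ≤ 2 * (1 / ((i : ℝ) + 1)) := by
        have h1 := hN (k i) i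
        have h2 : ∫ z in (C (k (i + 1)))ᶜ, ‖H (n i) z‖ ∂c < 1 / ((i : ℝ) + 1) :=
          hJ (n i) i (k i)
        rw [two_mul]
        exact add_le_add h1.le h2.le
  -- The union of the even annuli: `A` avoids the hump of `H (n i)` for odd `i`, and `Aᶜ` avoids it
  -- for even `i`.
  let A : Set S := ⋃ i, C (k (2 * i + 1)) \ C (k (2 * i))
  have hA : MeasurableSet A := MeasurableSet.iUnion fun i => (hCm _).diff (hCm _)
  have hodd : ∀ i, A ⊆ C (k (2 * i + 1)) ∪ (C (k (2 * i + 1 + 1)))ᶜ := by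
    intro i z hz
    obtain ⟨p, hp⟩ := Set.mem_iUnion.1 hz
    rcases le_or_gt p i with h | h
    · exact Or.inl (hmono (hk (by omega : 2 * p + 1 ≤ 2 * i + 1)) hp.1)
    · exact Or.inr fun hz' => hp.2 (hmono (hk (by omega : 2 * i + 1 + 1 ≤ 2 * p)) hz')
  have heven : ∀ i, Aᶜ ⊆ C (k (2 * i)) ∪ (C (k (2 * i + 1)))ᶜ := by
    intro i z hz
    by_contra hcon
    simp only [Set.mem_union, Set.mem_compl_iff, not_or, not_not] at hcon
    exact hz (Set.mem_iUnion.2 ⟨i, hcon.2, hcon.1⟩)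
  have hlim : ∀ e : ℕ → ℕ, Tendsto e atTop atTop →
      Tendsto (fun i => 2 * (1 / ((e i : ℝ) + 1))) atTop (𝓝 0) := by
    intro e he
    simpa using (tendsto_one_div_add_atTop_nhds_zero_nat (𝕜 := ℝ)).comp he |>.const_mul 2
  have h2i : Tendsto (fun i : ℕ => 2 * i) atTop atTop :=
    tendsto_atTop_mono (fun i => by simp only [id]; omega) tendsto_id
  have h2i1 : Tendsto (fun i : ℕ => 2 * i + 1) atTop atTop :=
    tendsto_atTop_mono (fun i => by simp only [id]; omega) tendsto_id
  obtain ⟨l, hl⟩ := hc A hA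
  obtain ⟨l', hl'⟩ := hc Set.univ MeasurableSet.univ
  simp only [Measure.restrict_univ] at hl'
  have hA0 : Tendsto (fun i => ∫ z in A, H (n (2 * i + 1)) z ∂c) atTop (𝓝 0) :=
    squeeze_zero_norm (fun i => hsmall A (2 * i + 1) hA (hodd i)) (hlim _ h2i1)
  have hA1 : Tendsto (fun i => ∫ z in Aᶜ, H (n (2 * i)) z ∂c) atTop (𝓝 0) :=
    squeeze_zero_norm (fun i => hsmall Aᶜ (2 * i) hA.compl (heven i)) (hlim _ h2i)
  -- Odd indices identify the limit over `A` as `1`; along even indices the full integral differs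
  -- from the one over `A` by `o(1)`, so the full limit is `1` too.
  have hl1 : l = 1 := by
    refine tendsto_nhds_unique (hl.comp (hntop.comp h2i1)) ?_
    simpa [Function.comp_def] using (Complex.continuous_exp.tendsto 0).comp hA0
  have hl'1 : l' = 1 := by
    refine tendsto_nhds_unique (hl'.comp (hntop.comp h2i)) ?_
    have h1 := (hl.comp (hntop.comp h2i)).mul ((Complex.continuous_exp.tendsto 0).comp hA1)
    rw [hl1, Complex.exp_zero, one_mul] at h1
    refine h1.congr fun i => ?_
    simp only [Function.comp_apply]
    rw [← Complex.exp_add, integral_add_compl hA (hi _)]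
  rwa [hl'1] at hl'

end Analytic

/-! ### The Lévy–Khintchine exponent: continuity and a doubling inequality -/

section Exponent

/-- The integrand of the Lévy–Khintchine formula. -/
noncomputable def levyIntegrand (θ z : ℝ) : ℂ :=
  Complex.exp (Complex.I * θ * z) - 1 - Complex.I * θ * (if |z| ≤ 1 then z else 0 : ℝ)

theorem levyExponent_eq (a b : ℝ) (ν : Measure ℝ) (θ : ℝ) :
    levyExponent a b ν θ =
      Complex.I * θ * a - θ ^ 2 * b / 2 + ∫ z, levyIntegrand θ z ∂ν := rfl

theorem measurable_levyIntegrand (θ : ℝ) : Measurable (levyIntegrand θ) := by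
  have : Measurable fun z : ℝ => (if |z| ≤ 1 then z else 0 : ℝ) :=
    Measurable.ite (measurableSet_le measurable_norm measurable_const) measurable_id
      measurable_const
  unfold levyIntegrand
  fun_prop

theorem norm_exp_I_mul_sub_one_le_two (y : ℝ) : ‖Complex.exp (Complex.I * y) - 1‖ ≤ 2 := by
  refine (norm_sub_le _ _).trans ?_
  rw [Complex.norm_exp_I_mul_ofReal]
  norm_num

/-- Taylor's estimate handles `|y| ≤ 1`; beyond that, `2 + |y| ≤ 3 * y ^ 2`. -/
theorem norm_exp_I_mul_sub_one_sub_le (y : ℝ) :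
    ‖Complex.exp (Complex.I * y) - 1 - Complex.I * y‖ ≤ 3 * y ^ 2 := by
  have hn : ‖Complex.I * (y : ℂ)‖ = |y| := by simp
  rcases le_or_gt |y| 1 with h | h
  · have := Complex.norm_exp_sub_one_sub_id_le (x := Complex.I * y) (by rw [hn]; exact h)
    rw [hn, sq_abs] at this
    nlinarith [sq_nonneg y]
  · have := (norm_sub_le (Complex.exp (Complex.I * y) - 1) (Complex.I * y)).trans
      (add_le_add_left (norm_exp_I_mul_sub_one_le_two y) _)
    rw [hn] at this
    nlinarith [sq_abs y]

/-- Uniformity over `|θ| ≤ M` supplies the dominating function for continuity in `θ`. The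
compensator gives a quadratic bound for small jumps; for `|z| > 1` it vanishes and the trivial bound
`2` suffices. -/
theorem norm_levyIntegrand_le {θ M : ℝ} (hθ : |θ| ≤ M) (z : ℝ) :
    ‖levyIntegrand θ z‖ ≤ (3 * M ^ 2 + 2) * min 1 (z ^ 2) := by
  have hM : θ ^ 2 ≤ M ^ 2 := by rw [← sq_abs]; gcongr
  unfold levyIntegrand
  split_ifs with h
  · have h1 := norm_exp_I_mul_sub_one_sub_le (θ * z)
    push_cast at h1
    rw [← mul_assoc] at h1
    have hz : z ^ 2 ≤ 1 := by rw [← sq_abs]; nlinarith [abs_nonneg z]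
    rw [min_eq_right hz]
    refine h1.trans ?_
    nlinarith [mul_le_mul_of_nonneg_right hM (sq_nonneg z), sq_nonneg z]
  · have h1 := norm_exp_I_mul_sub_one_le_two (θ * z)
    push_cast at h1
    rw [← mul_assoc] at h1
    have hz : 1 ≤ z ^ 2 := by rw [← sq_abs]; nlinarith [not_le.1 h]
    rw [min_eq_left hz]
    simp only [Complex.ofReal_zero, mul_zero, sub_zero, mul_one]
    nlinarith [sq_nonneg M]

variable {ν : Measure ℝ}

theorem integrable_min_one_sq
    (hν : ∫⁻ z : ℝ, ENNReal.ofReal (min 1 (z ^ 2)) ∂ν < ⊤) :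
    Integrable (fun z : ℝ => min 1 (z ^ 2)) ν := by
  refine ⟨by fun_prop, ?_⟩
  rw [hasFiniteIntegral_iff_ofReal (Eventually.of_forall fun z => by positivity)]
  exact hν

theorem integrable_levyIntegrand
    (hν : ∫⁻ z : ℝ, ENNReal.ofReal (min 1 (z ^ 2)) ∂ν < ⊤) (θ : ℝ) :
    Integrable (levyIntegrand θ) ν :=
  ((integrable_min_one_sq hν).const_mul _).mono'
    (measurable_levyIntegrand θ).aestronglyMeasurable
    (Eventually.of_forall fun z => norm_levyIntegrand_le le_rfl z)

theorem continuous_levyExponent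
    (hν : ∫⁻ z : ℝ, ENNReal.ofReal (min 1 (z ^ 2)) ∂ν < ⊤) (a b : ℝ) :
    Continuous (levyExponent a b ν) := by
  simp only [funext (levyExponent_eq a b ν)]
  refine Continuous.add (by fun_prop) (continuous_iff_continuousAt.2 fun θ => ?_)
  refine continuousAt_of_dominated (bound := fun z => (3 * (|θ| + 1) ^ 2 + 2) * min 1 (z ^ 2))
    (Eventually.of_forall fun θ => (measurable_levyIntegrand θ).aestronglyMeasurable) ?_
    ((integrable_min_one_sq hν).const_mul _) ?_
  · have : ∀ᶠ x in 𝓝 θ, |x| < |θ| + 1 :=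
      (continuous_abs.tendsto θ).eventually (gt_mem_nhds (lt_add_one _))
    filter_upwards [this] with x hx
    exact Eventually.of_forall fun z => norm_levyIntegrand_le hx.le z
  · refine Eventually.of_forall fun z => Continuous.continuousAt ?_
    unfold levyIntegrand
    fun_prop

theorem levyExponent_zero (a b : ℝ) (ν : Measure ℝ) : levyExponent a b ν 0 = 0 := by
  simp [levyExponent]

theorem re_levyIntegrand (θ z : ℝ) : (levyIntegrand θ z).re = Real.cos (θ * z) - 1 := by
  simp [levyIntegrand, Complex.exp_re]

theorem re_levyExponent
    (hν : ∫⁻ z : ℝ, ENNReal.ofReal (min 1 (z ^ 2)) ∂ν < ⊤) (a b θ : ℝ) :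
    (levyExponent a b ν θ).re = -(θ ^ 2 * b / 2) + ∫ z, (Real.cos (θ * z) - 1) ∂ν := by
  have h1 : (∫ z, levyIntegrand θ z ∂ν).re = ∫ z, (levyIntegrand θ z).re ∂ν :=
    (integral_re (integrable_levyIntegrand hν θ)).symm
  have h2 : Complex.I * θ * a - θ ^ 2 * b / 2 =
      ((-(θ ^ 2 * b / 2) : ℝ) : ℂ) + ((θ * a : ℝ) : ℂ) * Complex.I := by
    push_cast; ring
  rw [levyExponent_eq, Complex.add_re, h1, h2]
  simp only [re_levyIntegrand, Complex.add_re, Complex.ofReal_re, Complex.re_ofReal_mul,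
    Complex.I_re, mul_zero, add_zero]

theorem integrable_cos_sub_one
    (hν : ∫⁻ z : ℝ, ENNReal.ofReal (min 1 (z ^ 2)) ∂ν < ⊤) (θ : ℝ) :
    Integrable (fun z => Real.cos (θ * z) - 1) ν :=
  (integrable_levyIntegrand hν θ).re.congr
    (Eventually.of_forall fun z => re_levyIntegrand θ z)

/-- Doubling the argument multiplies the real part of the exponent by at most `4`. -/
theorem four_mul_re_levyExponent_le
    (hν : ∫⁻ z : ℝ, ENNReal.ofReal (min 1 (z ^ 2)) ∂ν < ⊤) (a b θ : ℝ) :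
    4 * (levyExponent a b ν θ).re ≤ (levyExponent a b ν (2 * θ)).re := by
  rw [re_levyExponent hν, re_levyExponent hν]
  have : 4 * ∫ z, (Real.cos (θ * z) - 1) ∂ν ≤ ∫ z, (Real.cos (2 * θ * z) - 1) ∂ν := by
    rw [← integral_const_mul]
    refine integral_mono ((integrable_cos_sub_one hν θ).const_mul 4)
      (integrable_cos_sub_one hν (2 * θ)) fun z => ?_
    change 4 * (Real.cos (θ * z) - 1) ≤ Real.cos (2 * θ * z) - 1
    -- The difference of the two sides is `2 * (cos (θ * z) - 1) ^ 2`; the Gaussian term scales by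
    -- exactly `4`.
    rw [mul_assoc 2, Real.cos_two_mul]
    nlinarith [sq_nonneg (Real.cos (θ * z) - 1)]
  nlinarith

end Exponent

/-! ### Finite additivity and independence of a Lévy basis -/

section Basis

variable {S Ω : Type*} [MeasurableSpace S] [MeasurableSpace Ω]

/-- A class of measurable sets containing the empty set and stable under measurable subsets. -/
structure IsHereditary (𝓑 : Set (Set S)) : Prop where
  measurableSet : ∀ E ∈ 𝓑, MeasurableSet E
  empty_mem : ∅ ∈ 𝓑
  subset_mem : ∀ E ∈ 𝓑, ∀ F, MeasurableSet F → F ⊆ E → F ∈ 𝓑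

variable {P : Measure Ω} {𝓑 : Set (Set S)} {L : Set S → Ω → ℝ}

/-- Additivity for the constant sequence `∅` makes `n * L ∅` converge, so its increments `L ∅` must
be `0`. -/
theorem IsLevyBasis.ae_empty (hL : IsLevyBasis P 𝓑 L) (h𝓑 : IsHereditary 𝓑) :
    ∀ᵐ ω ∂P, L ∅ ω = 0 := by
  have h := hL.sigma_additive (fun _ => ∅) (fun _ => h𝓑.empty_mem)
    (fun _ _ _ => disjoint_bot_left) (by simpa using h𝓑.empty_mem)
  filter_upwards [h] with ω hω
  simp only [Set.iUnion_empty, Finset.sum_const, Finset.card_range, nsmul_eq_mul] at hω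
  have h1 := ((tendsto_add_atTop_iff_nat 1).2 hω).sub hω
  rw [sub_self] at h1
  refine tendsto_nhds_unique (tendsto_const_nhds.congr fun n => ?_) h1
  push_cast
  ring

/-- The axioms of a Lévy basis concern sequences; padding with `∅` brings finite families within
their reach. -/
theorem exists_disjoint_sequence_extension {ι : Type*} [Fintype ι] {E : ι → Set S}
    (h𝓑 : IsHereditary 𝓑) (hE : ∀ i, E i ∈ 𝓑) (hd : Pairwise (Function.onFun Disjoint E)) :
    ∃ (e : ι ↪ ℕ) (F : ℕ → Set S), (∀ i, F (e i) = E i) ∧ (∀ j, j ∉ Set.range e → F j = ∅) ∧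
      (∀ j, F j ∈ 𝓑) ∧ Pairwise (Function.onFun Disjoint F) ∧ ⋃ j, F j = ⋃ i, E i := by
  let e : ι ↪ ℕ := (Fintype.equivFin ι).toEmbedding.trans Fin.valEmbedding
  have hF : ∀ i, Function.extend e E (fun _ => ∅) (e i) = E i :=
    fun i => e.injective.extend_apply _ _ i
  have hF' : ∀ j, j ∉ Set.range e → Function.extend e E (fun _ => ∅) j = ∅ :=
    fun j hj => Function.extend_apply' _ _ _ hj
  refine ⟨e, Function.extend e E fun _ => ∅, hF, hF', fun j => ?_, fun j k hjk => ?_, ?_⟩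
  · by_cases hj : j ∈ Set.range e
    · obtain ⟨i, rfl⟩ := hj
      rw [hF]; exact hE i
    · rw [hF' j hj]; exact h𝓑.empty_mem
  · by_cases hj : j ∈ Set.range e
    · by_cases hk : k ∈ Set.range e
      · obtain ⟨i, rfl⟩ := hj
        obtain ⟨i', rfl⟩ := hk
        simp only [Function.onFun, hF]
        exact hd fun h => hjk (h ▸ rfl)
      · simp only [Function.onFun, hF' k hk]; exact disjoint_bot_right
    · simp only [Function.onFun, hF' j hj]; exact disjoint_bot_left
  · apply Set.Subset.antisymm
    · refine Set.iUnion_subset fun j => ?_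
      by_cases hj : j ∈ Set.range e
      · obtain ⟨i, rfl⟩ := hj
        rw [hF]; exact Set.subset_iUnion E i
      · rw [hF' j hj]; exact Set.empty_subset _
    · exact Set.iUnion_subset fun i => (hF i) ▸ Set.subset_iUnion _ (e i)

theorem IsLevyBasis.ae_iUnion_eq_sum (hL : IsLevyBasis P 𝓑 L) (h𝓑 : IsHereditary 𝓑)
    {ι : Type*} [Fintype ι] {E : ι → Set S} (hE : ∀ i, E i ∈ 𝓑)
    (hd : Pairwise (Function.onFun Disjoint E)) (hU : ⋃ i, E i ∈ 𝓑) :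
    ∀ᵐ ω ∂P, L (⋃ i, E i) ω = ∑ i, L (E i) ω := by
  obtain ⟨e, F, hF, hF', hFm, hFd, hFU⟩ := exists_disjoint_sequence_extension h𝓑 hE hd
  filter_upwards [hL.sigma_additive F hFm hFd (hFU ▸ hU), hL.ae_empty h𝓑] with ω hω h0
  rw [hFU] at hω
  refine tendsto_nhds_unique hω (tendsto_const_nhds.congr' ?_)
  filter_upwards [eventually_gt_atTop (Finset.univ.sup e)] with n hn
  rw [← Finset.sum_subset (s₁ := Finset.univ.map e), Finset.sum_map]
  · simp only [hF]
  · intro j hj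
    obtain ⟨i, -, rfl⟩ := Finset.mem_map.1 hj
    exact Finset.mem_range.2 ((Finset.le_sup (f := e) (Finset.mem_univ i)).trans_lt hn)
  · intro j _ hj
    rw [hF' j (by simpa using hj), h0]

theorem IsLevyBasis.iIndepFun_of_fintype (hL : IsLevyBasis P 𝓑 L) (h𝓑 : IsHereditary 𝓑)
    {ι : Type*} [Fintype ι] {E : ι → Set S} (hE : ∀ i, E i ∈ 𝓑)
    (hd : Pairwise (Function.onFun Disjoint E)) : iIndepFun (fun i => L (E i)) P := by
  obtain ⟨e, F, hF, -, hFm, hFd, -⟩ := exists_disjoint_sequence_extension h𝓑 hE hd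
  have := (hL.indep F hFm hFd).precomp e.injective
  simpa only [hF] using this

/-! ### Decomposition of overlapping sets into atoms -/

section Atoms

variable {κ : Type*} [Fintype κ]

open Classical in
/-- The members of the family `B` that contain the point `z`. -/
noncomputable def membership (B : κ → Set S) (z : S) : Finset κ :=
  Finset.univ.filter fun k => z ∈ B k

/-- The points lying in exactly those members of the family `B` that are indexed by `T`. -/
def atom (B : κ → Set S) (T : Finset κ) : Set S := {z | membership B z = T}

omit [MeasurableSpace S] in
theorem mem_membership {B : κ → Set S} {z : S} {k : κ} : k ∈ membership B z ↔ z ∈ B k := by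
  simp [membership]

omit [MeasurableSpace S] in
theorem pairwise_disjoint_atom (B : κ → Set S) {T T' : Finset κ} (h : T ≠ T') :
    Disjoint (atom B T) (atom B T') :=
  Set.disjoint_left.2 fun _ hz hz' => h (hz.symm.trans hz')

theorem measurableSet_atom {B : κ → Set S} (hB : ∀ k, MeasurableSet (B k)) (T : Finset κ) :
    MeasurableSet (atom B T) := by
  have : atom B T = ⋂ k, {z | k ∈ T ↔ z ∈ B k} := by
    ext z
    simp only [atom, Set.mem_ofPred_eq, Set.mem_iInter, Finset.ext_iff, mem_membership]
    exact forall_congr' fun k => iff_comm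
  rw [this]
  refine MeasurableSet.iInter fun k => ?_
  by_cases hk : k ∈ T
  · simpa [hk] using hB k
  · simp only [hk, false_iff]
    exact (hB k).compl

/-- The atom of the empty index set is the complement of all the `B k` and need not lie in `𝓑`; this
is why only nonempty `T` occur below. -/
theorem atom_mem (h𝓑 : IsHereditary 𝓑) {B : κ → Set S} (hB : ∀ k, B k ∈ 𝓑) {T : Finset κ}
    (hT : T.Nonempty) : atom B T ∈ 𝓑 := by
  obtain ⟨k, hk⟩ := hT
  refine h𝓑.subset_mem _ (hB k) _ (measurableSet_atom (fun k => h𝓑.measurableSet _ (hB k)) T) ?_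
  intro z hz
  have hz : membership B z = T := hz
  exact mem_membership.1 (hz ▸ hk)

omit [MeasurableSpace S] in
/-- A function of a finite linear combination of indicators, as a combination of the indicators of
the atoms. -/
theorem comp_sum_indicator_eq (ψ : ℝ → ℂ) (hψ : ψ 0 = 0) (B : κ → Set S) (a : κ → ℝ) (z : S) :
    ψ (∑ k, (B k).indicator (fun _ => a k) z) =
      ∑ T : {T : Finset κ // T.Nonempty},
        (atom B T.1).indicator (fun _ => ψ (∑ k ∈ T.1, a k)) z := by
  classical
  have h1 : ∑ k, (B k).indicator (fun _ => a k) z = ∑ k ∈ membership B z, a k := by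
    rw [membership, Finset.sum_filter]
    exact Finset.sum_congr rfl fun k _ => Set.indicator_apply _ _ _
  rw [h1]
  -- Only the atom of `membership B z` contains `z`; if no `B k` contains `z`, the value is `ψ 0 =
  -- 0`.
  by_cases hne : (membership B z).Nonempty
  · rw [Finset.sum_eq_single (⟨membership B z, hne⟩ : {T : Finset κ // T.Nonempty})
      (f := fun T => (atom B T.1).indicator (fun _ => ψ (∑ k ∈ T.1, a k)) z)]
    · exact (Set.indicator_of_mem (s := atom B (membership B z)) (a := z) rfl
        fun _ => ψ (∑ k ∈ membership B z, a k)).symm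
    · intro T _ hT
      exact Set.indicator_of_notMem (s := atom B T.1)
        (fun hz => hT (Subtype.ext (Eq.symm hz))) _
    · simp
  · rw [Finset.not_nonempty_iff_eq_empty.1 hne, Finset.sum_empty, hψ]
    refine (Finset.sum_eq_zero fun T _ => Set.indicator_of_notMem (fun hz => hne ?_) _).symm
    have hz : membership B z = T.1 := hz
    exact hz ▸ T.2

variable {c : Measure S}

theorem integrable_comp_sum_indicator (h𝓑 : IsHereditary 𝓑) (hc : ∀ E ∈ 𝓑, c E < ⊤)
    {ψ : ℝ → ℂ} (hψ : ψ 0 = 0) {B : κ → Set S} (hB : ∀ k, B k ∈ 𝓑) (a : κ → ℝ) :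
    Integrable (fun z => ψ (∑ k, (B k).indicator (fun _ => a k) z)) c := by
  simp only [comp_sum_indicator_eq ψ hψ]
  refine integrable_finsetSum _ fun T _ => ?_
  refine (integrable_indicator_iff (measurableSet_atom (fun k => h𝓑.measurableSet _ (hB k)) _)).2 ?_
  exact integrableOn_const (hc _ (atom_mem h𝓑 hB T.2)).ne

theorem integral_comp_sum_indicator (h𝓑 : IsHereditary 𝓑) (hc : ∀ E ∈ 𝓑, c E < ⊤)
    {ψ : ℝ → ℂ} (hψ : ψ 0 = 0) {B : κ → Set S} (hB : ∀ k, B k ∈ 𝓑) (a : κ → ℝ) :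
    ∫ z, ψ (∑ k, (B k).indicator (fun _ => a k) z) ∂c =
      ∑ T : {T : Finset κ // T.Nonempty}, c.real (atom B T.1) * ψ (∑ k ∈ T.1, a k) := by
  have hm := measurableSet_atom (fun k => h𝓑.measurableSet _ (hB k))
  simp only [comp_sum_indicator_eq ψ hψ]
  rw [integral_finsetSum]
  · refine Finset.sum_congr rfl fun T _ => ?_
    rw [integral_indicator_const _ (hm _), Complex.real_smul]
  · exact fun T _ => (integrable_indicator_iff (hm _)).2
      (integrableOn_const (hc _ (atom_mem h𝓑 hB T.2)).ne)

theorem IsLevyBasis.ae_sum_eq_sum_atom (hL : IsLevyBasis P 𝓑 L) (h𝓑 : IsHereditary 𝓑)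
    {B : κ → Set S} (hB : ∀ k, B k ∈ 𝓑) (a : κ → ℝ) :
    (fun ω => ∑ k, a k * L (B k) ω) =ᵐ[P]
      fun ω => ∑ T : {T : Finset κ // T.Nonempty}, (∑ k ∈ T.1, a k) * L (atom B T.1) ω := by
  classical
  -- Each `B k` is the union of the atoms with `k ∈ T`. Replacing the other atoms by `∅` gives every
  -- `k` the same index type, so the double sum can be interchanged.
  let E : κ → {T : Finset κ // T.Nonempty} → Set S := fun k T => if k ∈ T.1 then atom B T.1 else ∅
  have hE : ∀ k T, E k T ∈ 𝓑 := by
    intro k T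
    simp only [E]
    split_ifs
    exacts [atom_mem h𝓑 hB T.2, h𝓑.empty_mem]
  have hEd : ∀ k, Pairwise (Function.onFun Disjoint (E k)) := by
    intro k T T' hT
    simp only [Function.onFun, E]
    split_ifs
    · exact pairwise_disjoint_atom B fun h => hT (Subtype.ext h)
    all_goals simp
  have hEU : ∀ k, ⋃ T, E k T = B k := by
    intro k
    ext z
    simp only [Set.mem_iUnion, E]
    constructor
    · rintro ⟨T, hz⟩
      split_ifs at hz with hk
      · have hz : membership B z = T.1 := hz
        exact mem_membership.1 (hz ▸ hk)
      · exact hz.elim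
    · intro hz
      have hk := mem_membership.2 hz
      refine ⟨⟨membership B z, k, hk⟩, ?_⟩
      rw [if_pos hk]
      rfl
  have hae : ∀ᵐ ω ∂P, ∀ k, L (B k) ω = ∑ T, L (E k T) ω := by
    refine ae_all_iff.2 fun k => ?_
    have := hL.ae_iUnion_eq_sum h𝓑 (hE k) (hEd k) (by rw [hEU]; exact hB k)
    rwa [hEU] at this
  filter_upwards [hae, hL.ae_empty h𝓑] with ω hω h0
  simp only [hω, Finset.mul_sum, Finset.sum_mul]
  rw [Finset.sum_comm]
  refine Finset.sum_congr rfl fun T _ => ?_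
  rw [← Finset.sum_subset (Finset.subset_univ T.1)]
  · exact Finset.sum_congr rfl fun k hk => by simp only [E, if_pos hk]
  · intro k _ hk
    simp only [E, if_neg hk, h0, mul_zero]

/-- The characteristic function of a linear combination of values of a Lévy basis. -/
theorem charFun_map_sum_levyBasis [IsProbabilityMeasure P] {a₀ b : ℝ} {ν : Measure ℝ}
    (hL : IsLevyBasis P 𝓑 L) (hQ : HasCharQuadruplet P 𝓑 L a₀ b ν c) (h𝓑 : IsHereditary 𝓑)
    {B : κ → Set S} (hB : ∀ k, B k ∈ 𝓑) (a : κ → ℝ) :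
    charFun (P.map fun ω => ∑ k, a k * L (B k) ω) 1 =
      Complex.exp (∫ z, levyExponent a₀ b ν (∑ k, (B k).indicator (fun _ => a k) z) ∂c) := by
  classical
  have hat : ∀ T : {T : Finset κ // T.Nonempty}, atom B T.1 ∈ 𝓑 := fun T => atom_mem h𝓑 hB T.2
  have hind : iIndepFun (fun (T : {T : Finset κ // T.Nonempty}) ω =>
      (∑ k ∈ T.1, a k) * L (atom B T.1) ω) P :=
    (hL.iIndepFun_of_fintype h𝓑 hat fun T T' h =>
      pairwise_disjoint_atom B fun h' => h (Subtype.ext h')).comp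
      (fun T x => (∑ k ∈ T.1, a k) * x) fun T => measurable_const_mul _
  -- Rewriting over the disjoint atoms makes the summands independent, even though the `B k` may
  -- overlap.
  rw [Measure.map_congr (hL.ae_sum_eq_sum_atom h𝓑 hB a),
    hind.charFun_map_fun_sum_eq_prod
      fun T => ((hL.measurable _ (hat T)).const_mul _).aemeasurable,
    integral_comp_sum_indicator h𝓑 hQ.finite (levyExponent_zero a₀ b ν) hB, Complex.exp_sum,
    Finset.prod_apply]
  refine Finset.prod_congr rfl fun T _ => ?_
  rw [charFun_map_mul_comp (hL.measurable _ (hat T)).aemeasurable, mul_one,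
    hQ.levy_khintchine _ (hat T)]

end Atoms

/-! ### Integrals of several simple functions -/

section Simple

variable {ι : Type*} [Fintype ι] {c : Measure S} {a b : ℝ} {ν : Measure ℝ}

theorem measurable_eval (h𝓑 : IsHereditary 𝓑) (g : SimpleFn 𝓑) : Measurable g.eval := by
  unfold SimpleFn.eval
  exact Finset.measurable_sum _ fun j _ =>
    measurable_const.indicator (h𝓑.measurableSet _ (g.mem j))

theorem inter_mem (h𝓑 : IsHereditary 𝓑) {A E : Set S} (hA : MeasurableSet A) (hE : E ∈ 𝓑) :
    A ∩ E ∈ 𝓑 :=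
  h𝓑.subset_mem _ hE _ (hA.inter (h𝓑.measurableSet _ hE)) Set.inter_subset_right

theorem measurable_integral (hL : IsLevyBasis P 𝓑 L) (h𝓑 : IsHereditary 𝓑) (g : SimpleFn 𝓑)
    {A : Set S} (hA : MeasurableSet A) : Measurable (g.integral L A) := by
  unfold SimpleFn.integral
  exact Finset.measurable_sum _ fun j _ =>
    (hL.measurable _ (inter_mem h𝓑 hA (g.mem j))).const_mul _

omit [MeasurableSpace S] in
-- Merging the partitions of all the `g i` into one sigma-indexed, possibly overlapping family
-- reduces the joint law to the atom computation.
theorem sum_mul_eval (g : ι → SimpleFn 𝓑) (θ : ι → ℝ) (z : S) :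
    ∑ i, θ i * (g i).eval z =
      ∑ k : (i : ι) × Fin (g i).m, ((g k.1).E k.2).indicator (fun _ => θ k.1 * (g k.1).y k.2) z := by
  rw [Fintype.sum_sigma]
  refine Finset.sum_congr rfl fun i _ => ?_
  rw [SimpleFn.eval, Finset.mul_sum]
  exact Finset.sum_congr rfl fun j _ => (Set.indicator_const_mul _ _ _ _).symm

theorem integrable_levyExponent_sum_eval (hQ : HasCharQuadruplet P 𝓑 L a b ν c)
    (h𝓑 : IsHereditary 𝓑) (g : ι → SimpleFn 𝓑) (θ : ι → ℝ) :
    Integrable (fun z => levyExponent a b ν (∑ i, θ i * (g i).eval z)) c := by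
  simp only [sum_mul_eval]
  exact integrable_comp_sum_indicator h𝓑 hQ.finite (levyExponent_zero a b ν)
    (B := fun k : (i : ι) × Fin (g i).m => (g k.1).E k.2) (fun k => (g k.1).mem k.2)
    (fun k => θ k.1 * (g k.1).y k.2)

/-- The joint characteristic function of the integrals of simple functions. -/
theorem charFun_map_sum_integral [IsProbabilityMeasure P] (hL : IsLevyBasis P 𝓑 L)
    (hQ : HasCharQuadruplet P 𝓑 L a b ν c) (h𝓑 : IsHereditary 𝓑) (g : ι → SimpleFn 𝓑)
    (θ : ι → ℝ) {A : Set S} (hA : MeasurableSet A) :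
    charFun (P.map fun ω => ∑ i, θ i * (g i).integral L A ω) 1 =
      Complex.exp (∫ z in A, levyExponent a b ν (∑ i, θ i * (g i).eval z) ∂c) := by
  have h1 : (fun ω => ∑ i, θ i * (g i).integral L A ω) = fun ω =>
      ∑ k : (i : ι) × Fin (g i).m, (θ k.1 * (g k.1).y k.2) * L (A ∩ (g k.1).E k.2) ω := by
    ext ω
    rw [Fintype.sum_sigma]
    refine Finset.sum_congr rfl fun i _ => ?_
    rw [SimpleFn.integral, Finset.mul_sum]
    exact Finset.sum_congr rfl fun j _ => (mul_assoc _ _ _).symm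
  rw [h1, charFun_map_sum_levyBasis hL hQ h𝓑
    (B := fun k : (i : ι) × Fin (g i).m => A ∩ (g k.1).E k.2)
    (fun k => inter_mem h𝓑 hA ((g k.1).mem k.2)), ← integral_indicator hA]
  congr 2
  ext z
  by_cases hz : z ∈ A
  · rw [Set.indicator_of_mem hz, sum_mul_eval]
    congr 1
    refine Finset.sum_congr rfl fun k _ => ?_
    classical
    simp [Set.indicator_apply, hz]
  · rw [Set.indicator_of_notMem hz, ← levyExponent_zero a b ν]
    congr 1
    exact Finset.sum_eq_zero fun k _ => Set.indicator_of_notMem (fun h => hz h.1) _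

end Simple

end Basis

/-! ### Passage to the limit for stochastic integrals -/

section Limit

variable {S Ω : Type*} [MeasurableSpace S] [MeasurableSpace Ω]
  {P : Measure Ω} [IsProbabilityMeasure P] {𝓑 : Set (Set S)} {L : Set S → Ω → ℝ}
  {ι : Type*} [Fintype ι] {c : Measure S} {a b : ℝ} {ν : Measure ℝ}

/-- Convergence in probability of finitely many sequences implies convergence of the
characteristic functions of their linear combinations. -/
theorem tendsto_charFun_map_sum {X : ℕ → ι → Ω → ℝ} {W : ι → Ω → ℝ}
    (hX : ∀ n i, AEMeasurable (X n i) P)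
    (h : ∀ i, TendstoInMeasure P (fun n => X n i) atTop (W i)) (θ : ι → ℝ) :
    Tendsto (fun n => charFun (P.map fun ω => ∑ i, θ i * X n i ω) 1) atTop
      (𝓝 (charFun (P.map fun ω => ∑ i, θ i * W i ω) 1)) := by
  -- A deviation in the sup metric forces one in some coordinate, so a finite union bound gives
  -- joint convergence.
  have hpi : TendstoInMeasure P (fun n ω i => X n i ω) atTop (fun ω i => W i ω) := by
    intro ε hε
    have hsum : Tendsto (fun n => ∑ i, P {ω | ε ≤ edist (X n i ω) (W i ω)}) atTop (𝓝 0) := by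
      simpa using tendsto_finsetSum Finset.univ fun i _ => h i ε hε
    refine tendsto_of_tendsto_of_tendsto_of_le_of_le tendsto_const_nhds hsum
      (fun _ => zero_le) fun n => ?_
    refine (measure_mono fun ω hω => ?_).trans (measure_iUnion_fintype_le P _)
    by_contra hcon
    simp only [Set.mem_iUnion, Set.mem_ofPred_eq, not_exists, not_le] at hcon
    refine absurd (show ε ≤ edist (fun i => X n i ω) (fun i => W i ω) from hω) (not_le.2 ?_)
    rw [edist_pi_def]
    exact (Finset.sup_lt_iff hε).2 fun i _ => hcon i
  have hcont : Continuous fun v : ι → ℝ => ∑ i, θ i * v i := by fun_prop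
  have hd := (hpi.tendstoInDistribution fun n => aemeasurable_pi_iff.2 (hX n)).continuous_comp hcont
  exact ProbabilityMeasure.tendsto_iff_tendsto_charFun.1 hd.tendsto 1

theorem tendsto_exp_setIntegral (hL : IsLevyBasis P 𝓑 L)
    (hQ : HasCharQuadruplet P 𝓑 L a b ν c) (h𝓑 : IsHereditary 𝓑) {g : ι → ℕ → SimpleFn 𝓑}
    {A : Set S} (hA : MeasurableSet A) {W : ι → Ω → ℝ}
    (h : ∀ i, TendstoInMeasure P (fun n => (g i n).integral L A) atTop (W i)) (θ : ι → ℝ) :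
    Tendsto
      (fun n => Complex.exp (∫ z in A, levyExponent a b ν (∑ i, θ i * (g i n).eval z) ∂c)) atTop
      (𝓝 (charFun (P.map fun ω => ∑ i, θ i * W i ω) 1)) := by
  have := tendsto_charFun_map_sum (X := fun n i => (g i n).integral L A)
    (fun n i => (measurable_integral hL h𝓑 (g i n) hA).aemeasurable) h θ
  exact this.congr fun n => charFun_map_sum_integral hL hQ h𝓑 (fun i => g i n) θ hA

/-- The characteristic function of a limit of integrals of simple functions has no zeros. -/
theorem charFun_limit_ne_zero (hL : IsLevyBasis P 𝓑 L)
    (hQ : HasCharQuadruplet P 𝓑 L a b ν c) (h𝓑 : IsHereditary 𝓑) {g : ι → ℕ → SimpleFn 𝓑}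
    {A : Set S} (hA : MeasurableSet A) {W : ι → Ω → ℝ} (hW : ∀ i, AEMeasurable (W i) P)
    (h : ∀ i, TendstoInMeasure P (fun n => (g i n).integral L A) atTop (W i)) (θ : ι → ℝ) :
    charFun (P.map fun ω => ∑ i, θ i * W i ω) 1 ≠ 0 := by
  have hZ : AEMeasurable (fun ω => ∑ i, θ i * W i ω) P := by fun_prop
  set Φ := charFun (P.map fun ω => ∑ i, θ i * W i ω) with hΦ
  have := Measure.isProbabilityMeasure_map hZ
  have hlim : ∀ s : ℝ, Tendsto (fun n => Complex.exp
      (∫ z in A, levyExponent a b ν (s * ∑ i, θ i * (g i n).eval z) ∂c)) atTop (𝓝 (Φ s)) := by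
    intro s
    have h1 := tendsto_exp_setIntegral hL hQ h𝓑 hA h fun i => s * θ i
    simp only [mul_assoc, ← Finset.mul_sum] at h1
    rwa [charFun_map_mul_comp hZ, mul_one] at h1
  have hint : ∀ (s : ℝ) n,
      Integrable (fun z => levyExponent a b ν (s * ∑ i, θ i * (g i n).eval z)) (c.restrict A) := by
    intro s n
    have h1 := integrable_levyExponent_sum_eval hQ h𝓑 (fun i => g i n) fun i => s * θ i
    simp only [mul_assoc, ← Finset.mul_sum] at h1
    exact h1.integrableOn
  -- The doubling inequality for the exponent holds for each simple approximation, and survives in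
  -- the limit as an inequality for `‖Φ‖`.
  have hdouble : ∀ s : ℝ, ‖Φ s‖ ^ 4 ≤ ‖Φ (2 * s)‖ := by
    intro s
    refine le_of_tendsto_of_tendsto' ((hlim s).norm.pow 4) (hlim (2 * s)).norm fun n => ?_
    rw [Complex.norm_exp, Complex.norm_exp, ← Real.exp_nat_mul, Real.exp_le_exp]
    have hre : ∀ r : ℝ,
        (∫ z in A, levyExponent a b ν (r * ∑ i, θ i * (g i n).eval z) ∂c).re =
          ∫ z in A, (levyExponent a b ν (r * ∑ i, θ i * (g i n).eval z)).re ∂c :=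
      fun r => (integral_re (hint r n)).symm
    rw [hre, hre, ← integral_const_mul]
    refine integral_mono ((hint s n).re.const_mul _) (hint (2 * s) n).re fun z => ?_
    have := four_mul_re_levyExponent_le hQ.levy_measure a b (s * ∑ i, θ i * (g i n).eval z)
    rw [← mul_assoc] at this
    exact_mod_cast this
  -- A zero at `1` propagates to every `2⁻ᵏ`, against continuity and `Φ 0 = 1`.
  intro h0
  have hzero : ∀ k : ℕ, Φ ((1 / 2) ^ k) = 0 := by
    intro k
    induction k with
    | zero => simpa using h0
    | succ k ih =>
      have h2 := hdouble ((1 / 2) ^ (k + 1))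
      rw [show (2 : ℝ) * (1 / 2) ^ (k + 1) = (1 / 2) ^ k by ring, ih, norm_zero] at h2
      exact norm_eq_zero.1 (pow_eq_zero_iff (by norm_num) |>.1 (le_antisymm h2 (by positivity)))
  have hc : Tendsto (fun k : ℕ => Φ ((1 / 2) ^ k)) atTop (𝓝 (Φ 0)) :=
    ((continuous_charFun (μ := P.map fun ω => ∑ i, θ i * W i ω)).tendsto 0).comp
      (tendsto_pow_atTop_nhds_zero_of_lt_one (by norm_num) (by norm_num))
  simp only [hzero] at hc
  have := tendsto_nhds_unique hc tendsto_const_nhds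
  simp [hΦ] at this

/-- Stochastic integrals of functions that are carried to each other by a transformation preserving
the control measure have the same joint characteristic function. -/
theorem charFun_map_sum_stochIntegral_eq [SigmaFinite c] (hL : IsLevyBasis P 𝓑 L)
    (hQ : HasCharQuadruplet P 𝓑 L a b ν c) (h𝓑 : IsHereditary 𝓑) {τ : S ≃ᵐ S}
    (hτ : MeasurePreserving τ c c) {f f' : ι → S → ℝ} (hf : ∀ i z, f' i (τ z) = f i z)
    {Z Z' : ι → Ω → ℝ} (h : ∀ i, IsStochIntegral P 𝓑 L c (f i) (Z i))
    (h' : ∀ i, IsStochIntegral P 𝓑 L c (f' i) (Z' i)) (θ : ι → ℝ) :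
    charFun (P.map fun ω => ∑ i, θ i * Z i ω) 1 =
      charFun (P.map fun ω => ∑ i, θ i * Z' i ω) 1 := by
  choose _ hZ g hg hgA hgZ using h
  choose _ hZ' g' hg' hgA' hgZ' using h'
  have hψ := continuous_levyExponent hQ.levy_measure a b
  let F : ℕ → S → ℂ := fun n z => levyExponent a b ν (∑ i, θ i * (g i n).eval z)
  let F' : ℕ → S → ℂ := fun n z => levyExponent a b ν (∑ i, θ i * (g' i n).eval z)
  have hFi : ∀ n, Integrable (F n) c := fun n =>
    integrable_levyExponent_sum_eval hQ h𝓑 (fun i => g i n) θ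
  have hFi' : ∀ n, Integrable (F' n) c := fun n =>
    integrable_levyExponent_sum_eval hQ h𝓑 (fun i => g' i n) θ
  have hFm : ∀ n, Measurable (F n) := fun n => hψ.measurable.comp
    (Finset.measurable_sum _ fun i _ => (measurable_eval h𝓑 (g i n)).const_mul _)
  have hFm' : ∀ n, Measurable (F' n) := fun n => hψ.measurable.comp
    (Finset.measurable_sum _ fun i _ => (measurable_eval h𝓑 (g' i n)).const_mul _)
  have hFτ : ∀ n, Integrable (fun z => F' n (τ z)) c := fun n =>
    hτ.integrable_comp_of_integrable (hFi' n)
  -- Exceptional null sets pull back to null sets under `τ`, and `f' i ∘ τ = f i` makes the two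
  -- limits equal.
  have hae : ∀ᵐ z ∂c, Tendsto (fun n => F n z - F' n (τ z)) atTop (𝓝 0) := by
    have h1 := ae_all_iff.2 hg
    have h2 := hτ.quasiMeasurePreserving.ae (ae_all_iff.2 hg')
    filter_upwards [h1, h2] with z hz hz'
    have l1 : Tendsto (fun n => F n z) atTop (𝓝 (levyExponent a b ν (∑ i, θ i * f i z))) :=
      (hψ.tendsto _).comp (tendsto_finsetSum _ fun i _ => (hz i).const_mul _)
    have l2 : Tendsto (fun n => F' n (τ z)) atTop
        (𝓝 (levyExponent a b ν (∑ i, θ i * f' i (τ z)))) :=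
      (hψ.tendsto _).comp (tendsto_finsetSum _ fun i _ => (hz' i).const_mul _)
    simp only [hf] at l2
    simpa using l1.sub l2
  -- Change of variables by `τ` turns the second integral over `A` into an integral over the image
  -- `τ(A) = τ.symm ⁻¹' A`.
  have hquot : ∀ A, MeasurableSet A → ∀ n,
      Complex.exp (∫ z in A, (F n z - F' n (τ z)) ∂c) =
        Complex.exp (∫ z in A, F n z ∂c) /
          Complex.exp (∫ z in τ.symm ⁻¹' A, F' n z ∂c) := by
    intro A hA n
    have h1 := hτ.setIntegral_preimage_emb τ.measurableEmbedding (F' n) (τ.symm ⁻¹' A)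
    have h2 : τ ⁻¹' (τ.symm ⁻¹' A) = A := by ext z; simp
    rw [h2] at h1
    rw [integral_sub (hFi n).integrableOn (hFτ n).integrableOn, h1, Complex.exp_sub]
  -- Convergence in probability over arbitrary measurable sets is essential here: the gliding-hump
  -- set depends on both approximating sequences.
  have hone := tendsto_exp_integral_of_ae_tendsto_zero c
    (fun n => (hFm n).sub ((hFm' n).comp τ.measurable)) (fun n => (hFi n).sub (hFτ n)) hae
    (fun A hA => by
      choose W hW hWt using fun i => hgA i A hA
      have hA' : MeasurableSet (τ.symm ⁻¹' A) := τ.symm.measurable hA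
      choose W' hW' hWt' using fun i => hgA' i _ hA'
      exact ⟨_, ((tendsto_exp_setIntegral hL hQ h𝓑 hA hWt θ).div
        (tendsto_exp_setIntegral hL hQ h𝓑 hA' hWt' θ)
        (charFun_limit_ne_zero hL hQ h𝓑 hA' hW' hWt' θ)).congr fun n => (hquot A hA n).symm⟩)
  have hne := charFun_limit_ne_zero hL hQ h𝓑 MeasurableSet.univ hZ' hgZ' θ
  have hdiv := (tendsto_exp_setIntegral hL hQ h𝓑 MeasurableSet.univ hgZ θ).div
    (tendsto_exp_setIntegral hL hQ h𝓑 MeasurableSet.univ hgZ' θ) hne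
  have hone' : Tendsto (fun n => Complex.exp (∫ z in Set.univ, F n z ∂c) /
      Complex.exp (∫ z in Set.univ, F' n z ∂c)) atTop (𝓝 1) :=
    hone.congr fun n => by
      have h1 := hquot Set.univ MeasurableSet.univ n
      rw [Set.preimage_univ] at h1
      rw [← h1, Measure.restrict_univ]
      rfl
  exact (div_eq_one_iff_eq hne).1 (tendsto_nhds_unique hdiv hone')

/-- Stochastic integrals of functions that are carried to each other by a transformation preserving
the control measure have the same joint distribution. -/
theorem identDistrib_stochIntegral [SigmaFinite c] (hL : IsLevyBasis P 𝓑 L)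
    (hQ : HasCharQuadruplet P 𝓑 L a b ν c) (h𝓑 : IsHereditary 𝓑) {τ : S ≃ᵐ S}
    (hτ : MeasurePreserving τ c c) {f f' : ι → S → ℝ} (hf : ∀ i z, f' i (τ z) = f i z)
    {Z Z' : ι → Ω → ℝ} (h : ∀ i, IsStochIntegral P 𝓑 L c (f i) (Z i))
    (h' : ∀ i, IsStochIntegral P 𝓑 L c (f' i) (Z' i)) :
    IdentDistrib (fun ω i => Z i ω) (fun ω i => Z' i ω) P P := by
  classical
  have hZ : AEMeasurable (fun ω i => Z i ω) P := aemeasurable_pi_iff.2 fun i => (h i).2.1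
  have hZ' : AEMeasurable (fun ω i => Z' i ω) P := aemeasurable_pi_iff.2 fun i => (h' i).2.1
  refine ⟨hZ, hZ', ?_⟩
  have := Measure.isProbabilityMeasure_map hZ
  have := Measure.isProbabilityMeasure_map hZ'
  -- Cramér–Wold: a linear functional on `ι → ℝ` is a combination of coordinates, so equality of
  -- characteristic functions at `1` for all `θ` suffices.
  refine Measure.ext_of_charFunDual (funext fun ℓ => ?_)
  have hℓ : ∀ v : ι → ℝ, ℓ v = ∑ i, ℓ (Pi.single i 1) * v i := by
    intro v
    conv_lhs => rw [pi_eq_sum_univ' v]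
    simp [map_sum, mul_comm]
  rw [charFunDual_eq_charFun_map_one, charFunDual_eq_charFun_map_one,
    AEMeasurable.map_map_of_aemeasurable ℓ.continuous.aemeasurable hZ,
    AEMeasurable.map_map_of_aemeasurable ℓ.continuous.aemeasurable hZ']
  simp only [Function.comp_def, hℓ (fun i => Z i _), hℓ (fun i => Z' i _)]
  exact charFun_map_sum_stochIntegral_eq hL hQ h𝓑 hτ hf h h' _

end Limit

/-! ### Space-time shifts of the control measure and the kernels -/

section Shift

variable {d : ℕ} {π : Measure (Set.Ioi (0 : ℝ))}

theorem isHereditary_boundedSets (d : ℕ) (π : Measure (Set.Ioi (0 : ℝ))) :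
    IsHereditary (boundedSets d π) where
  measurableSet _ hE := hE.1
  empty_mem := ⟨MeasurableSet.empty, by simp, by simp⟩
  subset_mem _ hE _ hF hFE :=
    ⟨hF, (measure_mono hFE).trans_lt hE.2.1, (measure_mono hFE).trans_lt hE.2.2⟩

/-- The shift of the space-time component. -/
noncomputable def shift (w : SpaceTime d) : ParamSpace d ≃ᵐ ParamSpace d :=
  (MeasurableEquiv.addRight w).prodCongr (MeasurableEquiv.refl _)

theorem shift_apply (w : SpaceTime d) (z : ParamSpace d) : shift w z = (z.1 + w, z.2) := rfl

theorem measurePreserving_shift [SFinite π] (w : SpaceTime d) :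
    MeasurePreserving (shift w) (controlMeasure d π) (controlMeasure d π) := by
  have : (volume : Measure (SpaceTime d)).IsAddRightInvariant :=
    inferInstanceAs (((volume : Measure (EuclideanSpace ℝ (Fin d))).prod
      (volume : Measure ℝ)).IsAddRightInvariant)
  exact (measurePreserving_add_right (volume : Measure (SpaceTime d)) w).prod
    (MeasurePreserving.id π)

/-- The ambit sets are translates of a single set, and the exponential depends on time only through
`t - s`, with the rate untouched. -/
theorem kernel_shift {A : ℝ → EuclideanSpace ℝ (Fin d) → Set (SpaceTime d)} (hA : IsAmbit A)
    (t ε : ℝ) (x u : EuclideanSpace ℝ (Fin d)) (z : ParamSpace d) :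
    kernel A (t + ε) (x + u) (shift (u, ε) z) = kernel A t x z := by
  classical
  have hmem : z.1 + (u, ε) ∈ A (t + ε) (x + u) ↔ z.1 ∈ A t x := by
    rw [hA.translation (t + ε) (x + u), hA.translation t x]
    simp only [Set.mem_image]
    refine exists_congr fun p => and_congr_right fun _ => ?_
    rw [show ((x + u, t + ε) : SpaceTime d) = (x, t) + (u, ε) from rfl, ← add_assoc,
      add_left_inj]
  simp only [kernel, Set.indicator_apply, shift_apply, Set.mem_ofPred_eq, hmem, Prod.snd_add,
    add_sub_add_right_eq_sub]

end Shift

end MSTOU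

theorem mainTheorem2 {d : ℕ} {Ω : Type*} [MeasurableSpace Ω]
    (P : MeasureTheory.Measure Ω) [MeasureTheory.IsProbabilityMeasure P]
    (Y : ℝ → EuclideanSpace ℝ (Fin d) → Ω → ℝ) (hY : MSTOU.IsMSTOU P Y) :
    MSTOU.IsStationary P Y := by
  obtain ⟨π, a, b, ν, L, A, hπ, hL, hQ, hA, hI⟩ := hY
  intro n x t u ε
  have : SigmaFinite (MSTOU.controlMeasure d π) := by
    unfold MSTOU.controlMeasure
    infer_instance
  exact MSTOU.identDistrib_stochIntegral hL hQ (MSTOU.isHereditary_boundedSets d π)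
    (MSTOU.measurePreserving_shift (u, ε))
    (fun i z => MSTOU.kernel_shift hA (t i) ε (x i) u z) (fun i => hI (t i) (x i))
    (fun i => hI (t i + ε) (x i + u))
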